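/- For a positive integer $d$ write $[d]=\{1,\dots,d\}$, and let $e_1,\dots,e_r$ be the standard unit vectors of $\mathbb{R}^r$. A partition of $n\ge 1$ is a non-increasing sequence of positive integers with sum $n$. For an integer matrix $A$, let $M[A]$ be its column vector matroid over $\mathbb{R}$: its elements are the (labels of the) columns of $A$, and a set of columns is independent if it is linearly independent over $\mathbb{R}$. For an integer $\Delta\ge 2$, a partition $\lambda=(\lambda_1,\dots,\lambda_m)$ of $\Delta-1$ and an integer $r\ge m+1$, let $A(\Delta,\lambda,r)$ be the integer matrix with $r$ rows and with the columns - $e_i$ for all $i\in[r]$; - $e_i-e_j$ for all $1\le i<j\le r$; - $k e_1+e_{i+1}$ for all $i\in[m]$ and $k\in[\lambda_i]$; - $k e_1+e_{i+1}-e_j$ for all $i\in[m]$, $k\in[\lambda_i]$ and $j\in[r]\setminus\{1,i+1\}$. For integers $\Delta\ge 1$ and $r\ge 2$, let $A(\Delta,r)$ be the integer matrix with $r$ rows and with the columns - $e_i$ for all $i\in[r]$; - $e_i-e_j$ for all $1\le i<j\le r$; - $k e_1-e_i$ for all $i\in\{2,\dots,r\}$ and $k\in\{2,\dots,\Delta\}$.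 Proposition. Let $\Delta\ge 2$ and $r\ge\Delta+1$ be integers. If $\lambda$ and $\lambda'$ are distinct partitions of $\Delta-1$, then the matroids $M[A(\Delta,\lambda,r)]$ and $M[A(\Delta,\lambda',r)]$ are not isomorphic. Moreover, for every partition $\lambda$ of $\Delta-1$, the matroid $M[A(\Delta,\lambda,r)]$ is not isomorphic to $M[A(\Delta,r)]$. -/

import Mathlib

/-- If the columns indexed by `J` are linearly independent and there are more of them than of the
linearly independent columns indexed by `I`, then some column of `J` can be added to `I`. -/
theorem vectorMatroid_augment {F n V : Type*} [Field F] [Finite n] [AddCommGroup V] [Module F V]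
    (v : n → V) {I J : Set n} (hI : LinearIndepOn F v I) (hJ : LinearIndepOn F v J)
    (h : I.ncard < J.ncard) : ∃ e ∈ J, e ∉ I ∧ LinearIndepOn F v (insert e I) := by
  classical
  haveI := Fintype.ofFinite n
  by_contra hcon
  push Not at hcon
  have hsub : v '' J ⊆ Submodule.span F (v '' I) := by
    rintro _ ⟨e, he, rfl⟩
    by_contra hspan
    by_cases heI : e ∈ I
    · exact hspan (Submodule.subset_span ⟨e, heI, rfl⟩)
    · exact hcon e he heI (hI.insert hspan)
  have hle : Submodule.span F (v '' J) ≤ Submodule.span F (v '' I) := Submodule.span_le.2 hsub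
  have key : ∀ K : Set n, LinearIndepOn F v K →
      Module.finrank F (Submodule.span F (v '' K)) = K.ncard := by
    intro K hK
    have := finrank_span_eq_card (b := fun x : K => v x) hK
    rw [Set.image_eq_range, this, ← Nat.card_eq_fintype_card, Nat.card_coe_set_eq]
  haveI : FiniteDimensional F (Submodule.span F (v '' I)) :=
    FiniteDimensional.span_of_finite F (Set.toFinite _)
  have := Submodule.finrank_mono hle
  rw [key J hJ, key I hI] at this
  omega

/-- The (column) vector matroid `M[A]` of a matrix `A` over a field: its ground set is the set of
all column indices, and a set of column indices is independent if the corresponding family of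
columns is linearly independent. -/
def vectorMatroid {F m n : Type*} [Field F] [Finite n] (A : Matrix m n F) : Matroid n :=
  (IndepMatroid.ofFinite (E := Set.univ) Set.finite_univ
    (fun I => LinearIndepOn F A.col I)
    (linearIndepOn_empty F _)
    (fun _ _ hJ hIJ => hJ.mono hIJ)
    (fun _ _ hI hJ h => vectorMatroid_augment A.col hI hJ h)
    (fun _ _ => Set.subset_univ _)).matroid

@[simp] theorem vectorMatroid_ground {F m n : Type*} [Field F] [Finite n] (A : Matrix m n F) :
    (vectorMatroid A).E = Set.univ := rfl

@[simp] theorem vectorMatroid_indep {F m n : Type*} [Field F] [Finite n] (A : Matrix m n F)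
    (I : Set n) : (vectorMatroid A).Indep I ↔ LinearIndepOn F A.col I := by
  simp [vectorMatroid]

/-- Two matroids are isomorphic if there is a bijection between their ground sets that preserves
independence and dependence of sets. -/
def MatroidIsomorphic {α β : Type*} (M : Matroid α) (N : Matroid β) : Prop :=
  ∃ φ : M.E ≃ N.E, ∀ I : Set M.E,
    M.Indep (Subtype.val '' I) ↔ N.Indep (Subtype.val '' (φ '' I))

/-- The standard unit vector of `ℤ ^ r` in the coordinate direction `i`, where coordinates are
counted from `0`; so `stdVec r 0` is the vector usually written `e₁`. -/
def stdVec (r i : ℕ) : Fin r → ℤ := fun t => if (t : ℕ) = i then 1 else 0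

/-- Labels of the columns `e_i` and of the columns `e_i - e_j` with `i < j`. -/
abbrev CliqueIdx (r : ℕ) : Type := Fin r ⊕ {p : Fin r × Fin r // p.1 < p.2}

/-- The columns `e_i`, and `e_i - e_j` for `i < j`. -/
def cliqueCol (r : ℕ) : CliqueIdx r → Fin r → ℤ
  | .inl i => stdVec r i
  | .inr p => stdVec r p.1.1 - stdVec r p.1.2

/-- Labels of the columns that depend on the sequence `lam`. With positions `i` in `lam`,
multiplicities `k` and coordinates `j` all counted from `0`, the first summand consists of the
pairs `(i, k)` with `k < lam i`, and the second one of the triples `(i, k, j)` with `k < lam i`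
and `j` different from `0` and from `i + 1`. -/
abbrev PartitionIdx {m : ℕ} (lam : Fin m → ℕ) (r : ℕ) : Type :=
  (Σ i : Fin m, Fin (lam i)) ⊕
    {q : (Σ i : Fin m, Fin (lam i)) × Fin r // (q.2 : ℕ) ≠ 0 ∧ (q.2 : ℕ) ≠ (q.1.1 : ℕ) + 1}

/-- The columns `k e_1 + e_{i+1}` and `k e_1 + e_{i+1} - e_j` for `1 ≤ k ≤ lam i` and
`j ∉ {1, i + 1}`, in the usual counting from `1`. -/
def partitionCol {m : ℕ} (lam : Fin m → ℕ) (r : ℕ) : PartitionIdx lam r → Fin r → ℤ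
  | .inl ⟨i, k⟩ => ((k : ℤ) + 1) • stdVec r 0 + stdVec r (i + 1)
  | .inr ⟨(⟨i, k⟩, j), _⟩ => ((k : ℤ) + 1) • stdVec r 0 + stdVec r (i + 1) - stdVec r j

/-- The non-increasing sequence of the parts of a partition. -/
def partitionSeq {n : ℕ} (lam : n.Partition) : Fin (lam.parts.sort (· ≥ ·)).length → ℕ :=
  (lam.parts.sort (· ≥ ·)).get

/-- The integer matrix `A(Δ, lam, r)` for a partition `lam` of `Δ - 1`. It is meant for `Δ ≥ 2`
and for `r` larger than the number of parts of `lam`. -/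
def matrixAPartition (Δ : ℕ) (lam : (Δ - 1).Partition) (r : ℕ) :
    Matrix (Fin r) (CliqueIdx r ⊕ PartitionIdx (partitionSeq lam) r) ℤ :=
  Matrix.of fun t c => Sum.elim (cliqueCol r) (partitionCol (partitionSeq lam) r) c t

/-- Labels `(i, k)` of the columns `k e_1 - e_i` of `A(Δ, r)`: coordinates `i` counted
from `0` with `i ≠ 0`, and `2 ≤ k ≤ Δ`. -/
abbrev LastIdx (Δ r : ℕ) : Type := {i : Fin r // (i : ℕ) ≠ 0} × {k : ℕ // k ∈ Finset.Icc 2 Δ}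

/-- The integer matrix `A(Δ, r)`: the columns `e_i`, the columns `e_i - e_j` for `i < j`, and the
columns `k e_1 - e_i` for `2 ≤ i ≤ r` and `2 ≤ k ≤ Δ` (coordinates counted from `1`). -/
def matrixA (Δ r : ℕ) : Matrix (Fin r) (CliqueIdx r ⊕ LastIdx Δ r) ℤ :=
  Matrix.of fun t c =>
    Sum.elim (cliqueCol r) (fun q => (q.2.1 : ℤ) • stdVec r 0 - stdVec r q.1.1) c t

/-- The vector matroid over `ℝ` of an integer matrix. -/
noncomputable def integerVectorMatroid {m n : Type*} [Finite n] (A : Matrix m n ℤ) : Matroid n :=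
  vectorMatroid (A.map (Int.cast : ℤ → ℝ))

/-! Count coordinates from 0, send `e_0` to a vector `e` and every other `e_i` to `δ_i - δ_0`. This
linear map is injective, and it turns the columns into `e`, the apex, and the vectors `δ_a - δ_b + k
e` with `0 ≤ k ≤ w a`, where for `k = 0` only one of the two signs occurs. The weights `w` are `1,
λ_1, …, λ_m, 0, …, 0` for `A(Δ, λ, r)` and `Δ, 0, …, 0` for `A(Δ, r)`
(`isLabelling_matrixAPartition`, `isLabelling_matrixA`).

The lines through the apex correspond to the pairs `{a, b}`, and each carries `w a + w b + 1`
further elements. A line that avoids the apex has at most three elements, because two of them span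
edges of a triangle and any other must lie over its third side. So the apex is on every line with at
least four elements (`IsLabelling.isHub_apex`), and no other element is as soon as two such lines
exist (`IsLabelling.labelEdge_eq_of_isHub`). An isomorphism therefore fixes the apex and preserves
the number of pairs with each sum `w a + w b` (`IsLabelling.ncard_linesOfLength`).

With `P = ∑ X ^ w a`, these numbers are the coefficients of `(P ^ 2 - P(X ^ 2)) / 2`, which
determine `P` because some weight is 0 (`card_filter_eq_of_pairsWithSum`); the bound `r ≥ Δ + 1`
supplies that weight. The weights give back `λ`, and weight 1 occurs for every `λ` but not for `A(Δ,
r)`. -/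

/-! ### Recovering a sequence from its pairwise sums -/

open Polynomial in
/-- A polynomial with positive constant coefficient is determined by `p ^ 2 - p (X ^ 2)`. -/
theorem eq_of_sq_sub_expand_eq {p q : ℤ[X]}
    (h : p ^ 2 - expand ℤ 2 p = q ^ 2 - expand ℤ 2 q)
    (hp : 1 ≤ p.coeff 0) (hq : 1 ≤ q.coeff 0) : p = q := by
  have key : (p - q) * (p + q) = expand ℤ 2 (p - q) := by
    rw [map_sub]; linear_combination h
  have hd : ∀ n, (p - q).coeff n = 0 := by
    intro n
    induction n using Nat.strong_induction_on with
    | _ n ih =>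
      have hn := congrArg (fun f => f.coeff n) key
      simp only [coeff_mul] at hn
      -- By induction the lower coefficients of `p - q` vanish, so only its `n`-th one survives,
      -- times the constant term of `p + q`, which is at least 2.
      rw [Finset.sum_eq_single (n, 0)] at hn
      · rw [coeff_expand (by norm_num)] at hn
        rcases Nat.eq_zero_or_pos n with rfl | hpos
        · simp only [dvd_zero, if_true, Nat.zero_div] at hn
          rw [coeff_add] at hn
          have : (p - q).coeff 0 * (p.coeff 0 + q.coeff 0 - 1) = 0 := by linear_combination hn
          rcases mul_eq_zero.1 this with h0 | h0
          · exact h0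
          · omega
        · have hz : (if 2 ∣ n then (p - q).coeff (n / 2) else 0) = 0 := by
            split_ifs
            · exact ih _ (by omega)
            · rfl
          rw [hz] at hn
          rcases mul_eq_zero.1 hn with h0 | h0
          · exact h0
          · have h1 : p.coeff 0 + q.coeff 0 = 0 := by simpa using h0
            omega
      · rintro ⟨i, j⟩ hij hne
        rw [Finset.HasAntidiagonal.mem_antidiagonal] at hij
        have : i < n := by
          rcases Nat.lt_or_ge i n with h | h
          · exact h
          · exact absurd (Prod.ext (by simp at hij ⊢; omega) (by simp at hij ⊢; omega)) hne
        simp [ih i this]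
      · intro hne
        exact absurd (by simp) hne
  exact sub_eq_zero.1 (Polynomial.ext fun n => by rw [hd, coeff_zero])

open Polynomial in
theorem coeff_sum_X_pow {ι : Type*} (s : Finset ι) (f : ι → ℕ) (n : ℕ) :
    (∑ a ∈ s, (X : ℤ[X]) ^ f a).coeff n = ((s.filter fun a => f a = n).card : ℤ) := by
  rw [finsetSum_coeff, Finset.card_filter]
  push_cast
  refine Finset.sum_congr rfl fun a _ => ?_
  rw [coeff_X_pow]
  simp [eq_comm]

/-- The pairs `a < b < r` with `w a + w b = s`. -/
def pairsWithSum (w : ℕ → ℕ) (r s : ℕ) : Finset (ℕ × ℕ) :=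
  (Finset.range r ×ˢ Finset.range r).filter fun p => p.1 < p.2 ∧ w p.1 + w p.2 = s

-- Squaring yields all ordered pairs; subtracting the substitution `X ↦ X ^ 2` removes the diagonal
-- and leaves every unordered pair twice.
open Polynomial in
theorem sq_sub_expand_sum_X_pow (w : ℕ → ℕ) (r : ℕ) :
    (∑ a ∈ Finset.range r, (X : ℤ[X]) ^ w a) ^ 2
        - expand ℤ 2 (∑ a ∈ Finset.range r, (X : ℤ[X]) ^ w a) =
      2 * ∑ p ∈ (Finset.range r ×ˢ Finset.range r).filter (fun p => p.1 < p.2),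
        (X : ℤ[X]) ^ (w p.1 + w p.2) := by
  induction r with
  | zero => simp
  | succ r ih =>
    have hsplit : (Finset.range (r + 1) ×ˢ Finset.range (r + 1)).filter (fun p => p.1 < p.2) =
        (Finset.range r ×ˢ Finset.range r).filter (fun p => p.1 < p.2) ∪
          (Finset.range r).image fun a => (a, r) := by
      ext ⟨a, b⟩
      simp only [Finset.mem_filter, Finset.mem_product, Finset.mem_range, Finset.mem_union,
        Finset.mem_image, Prod.mk.injEq]
      constructor
      · intro h
        by_cases hb : b = r
        · exact Or.inr ⟨a, by omega, rfl, hb.symm⟩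
        · exact Or.inl (by omega)
      · rintro (h | ⟨c, h1, h2, h3⟩) <;> omega
    rw [hsplit, Finset.sum_union, Finset.sum_image, mul_add, ← ih, Finset.sum_range_succ]
    · simp only [pow_add, ← Finset.sum_mul, map_add, map_pow, expand_X]
      ring
    · intro a _ b _ hab
      exact (Prod.mk.inj hab).1
    · rw [Finset.disjoint_left]
      rintro ⟨a, b⟩ h1 h2
      simp only [Finset.mem_filter, Finset.mem_product, Finset.mem_range,
        Finset.mem_image, Prod.mk.injEq] at h1 h2
      obtain ⟨c, h⟩ := h2
      omega

/-- A finite sequence of natural numbers that contains `0` is determined, up to order, by the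
multiset of its pairwise sums. -/
theorem card_filter_eq_of_pairsWithSum {w w' : ℕ → ℕ} {r : ℕ}
    (hw : ∃ a < r, w a = 0) (hw' : ∃ a < r, w' a = 0)
    (h : ∀ s, (pairsWithSum w r s).card = (pairsWithSum w' r s).card) (s : ℕ) :
    ((Finset.range r).filter fun a => w a = s).card =
      ((Finset.range r).filter fun a => w' a = s).card := by
  have hpos : ∀ v : ℕ → ℕ, (∃ a < r, v a = 0) →
      1 ≤ (∑ a ∈ Finset.range r, (Polynomial.X : Polynomial ℤ) ^ v a).coeff 0 := by
    rintro v ⟨a, ha, hva⟩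
    rw [coeff_sum_X_pow]
    exact_mod_cast Finset.card_pos.2 ⟨a, by simp [ha, hva]⟩
  have := eq_of_sq_sub_expand_eq
    (p := ∑ a ∈ Finset.range r, (Polynomial.X : Polynomial ℤ) ^ w a)
    (q := ∑ a ∈ Finset.range r, (Polynomial.X : Polynomial ℤ) ^ w' a) (by
      rw [sq_sub_expand_sum_X_pow, sq_sub_expand_sum_X_pow]
      congr 1
      ext n
      rw [coeff_sum_X_pow, coeff_sum_X_pow, Finset.filter_filter, Finset.filter_filter]
      exact_mod_cast h n) (hpos w hw) (hpos w' hw')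
  have hs := congrArg (fun f => f.coeff s) this
  simp only [coeff_sum_X_pow] at hs
  exact_mod_cast hs

/-! ### Linear relations between label vectors -/

/-- The vector `δ_a - δ_b + k e` attached to the label `(a, b, k)`, where `e` spans the second
factor. -/
noncomputable def labelVec (x : ℕ × ℕ × ℕ) : (ℕ → ℝ) × ℝ :=
  (fun c => (if c = x.1 then 1 else 0) - (if c = x.2.1 then 1 else 0), (x.2.2 : ℝ))

/-- The unordered pair of vertices of a label. -/
def labelEdge (x : ℕ × ℕ × ℕ) : Sym2 ℕ := s(x.1, x.2.1)

/-- The label of the vector `e`. -/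
abbrev apexLabel : ℕ × ℕ × ℕ := (0, 0, 1)

/-- The labels `(a, b, k)` with `a ≠ b`, `k ≤ w a`, and only one of the labels `(a, b, 0)` and
`(b, a, 0)`. -/
def IsPointLabel (w : ℕ → ℕ) (r : ℕ) (x : ℕ × ℕ × ℕ) : Prop :=
  x.1 < r ∧ x.2.1 < r ∧ x.1 ≠ x.2.1 ∧ x.2.2 ≤ w x.1 ∧
    (x.2.2 = 0 → x.2.1 = 0 ∨ x.1 ≠ 0 ∧ x.1 < x.2.1)

/-- Both endpoints of `y` have a nonzero coordinate, so they must be endpoints of `x`. -/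
theorem labelEdge_eq_of_smul {x y : ℕ × ℕ × ℕ} (hy : y.1 ≠ y.2.1) {c : ℝ}
    (h : c • (labelVec x).1 = (labelVec y).1) : labelEdge x = labelEdge y := by
  have h1 := congrFun h y.1
  have h2 := congrFun h y.2.1
  simp only [labelVec, Pi.smul_apply, smul_eq_mul, if_true, if_neg hy, if_neg hy.symm] at h1 h2
  have e1 : y.1 = x.1 ∨ y.1 = x.2.1 := by
    by_contra! hn
    simp [hn.1, hn.2] at h1
  have e2 : y.2.1 = x.1 ∨ y.2.1 = x.2.1 := by
    by_contra! hn
    simp [hn.1, hn.2] at h2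
  rw [labelEdge, labelEdge, Sym2.eq_iff]
  omega

/-- The matroid is simple. Parallel vectors share their edge; equal orientation forces equal `k`,
and opposite orientation forces both `k` to be 0, which the last clause of `IsPointLabel` rules out.
-/
theorem smul_labelVec_ne {w : ℕ → ℕ} {r : ℕ} {x y : ℕ × ℕ × ℕ}
    (hx : x = apexLabel ∨ IsPointLabel w r x) (hy : y = apexLabel ∨ IsPointLabel w r y)
    (hxy : x ≠ y) (c : ℝ) : c • labelVec x ≠ labelVec y := by
  intro h
  have h1 : c • (labelVec x).1 = (labelVec y).1 := congrArg Prod.fst h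
  have h2 : c * x.2.2 = y.2.2 := congrArg Prod.snd h
  obtain ⟨a, b, k⟩ := x
  obtain ⟨a', b', k'⟩ := y
  have hcoord := congrFun h1 a
  have hcoord' := congrFun h1 b
  simp only [IsPointLabel, Prod.mk.injEq, ne_eq, labelVec, Pi.smul_apply, smul_eq_mul] at *
  rcases hy with ⟨rfl, rfl, rfl⟩ | hy
  · rcases hx with hx | hx
    · omega
    · have hc : c = 0 := by simpa [hx.2.2.1] using hcoord
      simp [hc] at h2
  · have he := labelEdge_eq_of_smul (x := (a, b, k)) (y := (a', b', k')) hy.2.2.1 h1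
    rw [labelEdge, labelEdge, Sym2.eq_iff] at he
    have hab : a ≠ b := by
      have := hy.2.2.1
      dsimp only at he
      omega
    rcases hx with hx | hx
    · omega
    rcases he with ⟨h3, h4⟩ | ⟨h3, h4⟩ <;> dsimp only at h3 h4 <;> subst h3 h4
    · have hc : c = 1 := by simpa [hab] using hcoord
      rw [hc, one_mul] at h2
      exact hxy ⟨rfl, rfl, by exact_mod_cast h2⟩
    · have hc : c = -1 := by simpa [hab] using hcoord
      rw [hc] at h2
      have h5 : (k : ℝ) + k' = 0 := by linarith
      have h6 : k + k' = 0 := by exact_mod_cast h5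
      omega

/-- Three labels whose vectors are linearly related with nonzero coefficients form a triangle. -/
theorem labelEdge_eq_of_add {x y z u : ℕ × ℕ × ℕ} (hx : x.1 ≠ x.2.1) (hy : y.1 ≠ y.2.1)
    (hz : z.1 ≠ z.2.1) (hxy : labelEdge x ≠ labelEdge y)
    {α β α' β' : ℝ} (hα : α ≠ 0) (hβ : β ≠ 0) (hα' : α' ≠ 0) (hβ' : β' ≠ 0)
    (h : α • labelVec x + β • labelVec y = labelVec z)
    (h' : α' • labelVec x + β' • labelVec y = labelVec u) : labelEdge z = labelEdge u := by
  have key : ∀ (z : ℕ × ℕ × ℕ) (α β : ℝ), α ≠ 0 → β ≠ 0 →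
      α • labelVec x + β • labelVec y = labelVec z →
      (x.1 ≠ y.1 → x.1 ≠ y.2.1 → x.1 = z.1 ∨ x.1 = z.2.1) ∧
      (x.2.1 ≠ y.1 → x.2.1 ≠ y.2.1 → x.2.1 = z.1 ∨ x.2.1 = z.2.1) ∧
      (y.1 ≠ x.1 → y.1 ≠ x.2.1 → y.1 = z.1 ∨ y.1 = z.2.1) ∧
      (y.2.1 ≠ x.1 → y.2.1 ≠ x.2.1 → y.2.1 = z.1 ∨ y.2.1 = z.2.1) := by
    intro z α β hα hβ h
    have h1 : ∀ c, _ := fun c => congrFun (congrArg Prod.fst h) c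
    simp only [labelVec, Prod.fst_add, Prod.smul_fst, Pi.add_apply, Pi.smul_apply,
      smul_eq_mul] at h1
    refine ⟨fun e1 e2 => ?_, fun e1 e2 => ?_, fun e1 e2 => ?_, fun e1 e2 => ?_⟩ <;> by_contra! hn
    · exact hα (by simpa [e1, e2, hn.1, hn.2, hx] using h1 x.1)
    · exact hα (by simpa [e1, e2, hn.1, hn.2, hx.symm] using h1 x.2.1)
    · exact hβ (by simpa [e1, e2, hn.1, hn.2, hy] using h1 y.1)
    · exact hβ (by simpa [e1, e2, hn.1, hn.2, hy.symm] using h1 y.2.1)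
  have k1 := key z α β hα hβ h
  have k2 := key u α' β' hα' hβ' h'
  rw [labelEdge, labelEdge, ne_eq, Sym2.eq_iff] at hxy
  rw [labelEdge, labelEdge, Sym2.eq_iff]
  clear key h h'
  -- If the edges share a vertex, their two other vertices form the edge of both `z` and `u`. If
  -- they share none, `z` would need four endpoints.
  by_cases e1 : x.1 = y.1
  · grind
  by_cases e2 : x.1 = y.2.1
  · grind
  by_cases e3 : x.2.1 = y.1
  · grind
  by_cases e4 : x.2.1 = y.2.1
  · grind
  · grind

/-! ### The apex as the only hub -/

/-- A labelling of the elements of a matroid by `apexLabel` and the point labels, such that the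
matroid is represented by the vectors of the labels. -/
structure IsLabelling {α : Type*} (w : ℕ → ℕ) (r : ℕ) (M : Matroid α) (lab : α → ℕ × ℕ × ℕ) :
    Prop where
  inj : Function.Injective lab
  range : ∀ t, (∃ x, lab x = t) ↔ t = apexLabel ∨ IsPointLabel w r t
  indep : ∀ I, M.Indep I ↔ LinearIndepOn ℝ (fun x => labelVec (lab x)) I

/-- An element that lies on every line with at least four points. -/
def IsHub {α : Type*} (M : Matroid α) (e : α) : Prop :=
  ∀ x y z u, x ≠ y → z ≠ x → z ≠ y → u ≠ x → u ≠ y → z ≠ u →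
    ¬ M.Indep {z, x, y} → ¬ M.Indep {u, x, y} → e = x ∨ e = y ∨ ¬ M.Indep {e, x, y}

namespace IsLabelling

variable {α : Type*} {w : ℕ → ℕ} {r : ℕ} {M : Matroid α} {lab : α → ℕ × ℕ × ℕ}

theorem mem (h : IsLabelling w r M lab) (x : α) :
    lab x = apexLabel ∨ IsPointLabel w r (lab x) :=
  (h.range _).1 ⟨x, rfl⟩

theorem isPoint (h : IsLabelling w r M lab) {o x : α} (ho : lab o = apexLabel) (hx : x ≠ o) :
    IsPointLabel w r (lab x) :=
  (h.mem x).resolve_left fun hn => hx (h.inj (hn.trans ho.symm))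

theorem ne_of_isPointLabel {o x : α} (ho : lab o = apexLabel)
    (hx : IsPointLabel w r (lab x)) : x ≠ o := by
  rintro rfl
  rw [ho] at hx
  exact hx.2.2.1 rfl

theorem smul_ne (h : IsLabelling w r M lab) {x y : α} (hxy : x ≠ y) (c : ℝ) :
    c • labelVec (lab x) ≠ labelVec (lab y) :=
  smul_labelVec_ne (h.mem x) (h.mem y) (fun hn => hxy (h.inj hn)) c

theorem not_indep_iff (h : IsLabelling w r M lab) {x y z : α} (hxy : x ≠ y) (hzx : z ≠ x)
    (hzy : z ≠ y) : ¬ M.Indep {z, x, y} ↔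
      ∃ a b : ℝ, a • labelVec (lab x) + b • labelVec (lab y) = labelVec (lab z) := by
  have hx : labelVec (lab x) ≠ 0 := fun hx =>
    h.smul_ne hxy.symm 0 (by rw [zero_smul, hx])
  have hpair : LinearIndepOn ℝ (fun x => labelVec (lab x)) {x, y} :=
    (linearIndepOn_pair_iff (K := ℝ) (fun x => labelVec (lab x)) hxy hx).2
      fun c => h.smul_ne hxy c
  rw [h.indep, linearIndepOn_insert (by simp [hzx, hzy]), and_iff_right hpair, not_not,
    Set.image_pair, Submodule.mem_span_pair]

/-- Modulo `e`, a point becomes a signed edge vector, so collinearity with the apex means that the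
two edge vectors are proportional. -/
theorem apex_not_indep_iff (h : IsLabelling w r M lab) {o x y : α} (ho : lab o = apexLabel)
    (hx : x ≠ o) (hy : y ≠ o) (hxy : x ≠ y) :
    ¬ M.Indep {o, x, y} ↔ labelEdge (lab x) = labelEdge (lab y) := by
  have px := h.isPoint ho hx
  have py := h.isPoint ho hy
  have hvo : (labelVec (lab o)).1 = 0 := by
    rw [ho]; ext c; simp [labelVec]
  have hvo' : (labelVec (lab o)).2 = 1 := by
    rw [ho]; simp [labelVec]
  rw [h.not_indep_iff hxy hx.symm hy.symm]
  constructor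
  · rintro ⟨a, b, hab⟩
    have h1 : a • (labelVec (lab x)).1 + b • (labelVec (lab y)).1 = 0 := by
      rw [← hvo, ← hab]; rfl
    by_cases hb : b = 0
    · subst hb
      rw [zero_smul, add_zero] at hab
      exact absurd hab (h.smul_ne hx a)
    · refine labelEdge_eq_of_smul py.2.2.1 (c := -(b⁻¹ * a)) ?_
      have h2 : b⁻¹ • (a • (labelVec (lab x)).1 + b • (labelVec (lab y)).1) = 0 := by
        rw [h1, smul_zero]
      rw [smul_add, smul_smul, smul_smul, inv_mul_cancel₀ hb, one_smul] at h2
      rw [neg_smul]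
      exact neg_eq_of_add_eq_zero_right h2
  · intro he
    rw [labelEdge, labelEdge, Sym2.eq_iff] at he
    obtain ⟨c, hc⟩ : ∃ c : ℝ, c • (labelVec (lab x)).1 = (labelVec (lab y)).1 := by
      rcases he with ⟨h1, h2⟩ | ⟨h1, h2⟩
      · exact ⟨1, by simp [labelVec, h1, h2]⟩
      · exact ⟨-1, by ext t; simp [labelVec, h1, h2]⟩
    -- The difference `y - c x` is a multiple of `e`, and a nonzero one since `x` and `y` are not
    -- parallel.
    have hne : (labelVec (lab y)).2 - c * (labelVec (lab x)).2 ≠ 0 := fun hn =>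
      h.smul_ne hxy c (Prod.ext hc (by simpa using (sub_eq_zero.1 hn).symm))
    set d := (labelVec (lab y)).2 - c * (labelVec (lab x)).2 with hd
    refine ⟨-(d⁻¹ * c), d⁻¹, Prod.ext ?_ ?_⟩
    · rw [hvo, Prod.fst_add, Prod.smul_fst, Prod.smul_fst, ← hc, smul_smul, neg_smul,
        neg_add_cancel]
    · rw [hvo', Prod.snd_add, Prod.smul_snd, Prod.smul_snd, smul_eq_mul, smul_eq_mul]
      have : d⁻¹ * d = 1 := inv_mul_cancel₀ hne
      linear_combination this + d⁻¹ * hd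

/-- If the line of `x` and `y` missed the apex, `z` and `u` would both lie over the third side of
the triangle, so the apex would be on their line, which is the same line. -/
theorem isHub_apex (h : IsLabelling w r M lab) {o : α} (ho : lab o = apexLabel) : IsHub M o := by
  intro x y z u hxy hzx hzy hux huy hzu hz hu
  by_contra! hcon
  obtain ⟨hox, hoy, hind⟩ := hcon
  have hzo : z ≠ o := by rintro rfl; exact hz hind
  have huo : u ≠ o := by rintro rfl; exact hu hind
  have hedge : labelEdge (lab x) ≠ labelEdge (lab y) := fun he =>
    (h.apex_not_indep_iff ho hox.symm hoy.symm hxy).2 he hind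
  obtain ⟨a, b, hab⟩ := (h.not_indep_iff hxy hzx hzy).1 hz
  obtain ⟨a', b', hab'⟩ := (h.not_indep_iff hxy hux huy).1 hu
  have hcoef : ∀ (z : α) (a b : ℝ), z ≠ x → z ≠ y →
      a • labelVec (lab x) + b • labelVec (lab y) = labelVec (lab z) → a ≠ 0 ∧ b ≠ 0 := by
    rintro z a b hzx hzy hab
    refine ⟨?_, ?_⟩ <;> rintro rfl
    · rw [zero_smul, zero_add] at hab
      exact h.smul_ne hzy.symm b hab
    · rw [zero_smul, add_zero] at hab
      exact h.smul_ne hzx.symm a hab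
  obtain ⟨ha, hb⟩ := hcoef z a b hzx hzy hab
  obtain ⟨ha', hb'⟩ := hcoef u a' b' hux huy hab'
  have he := labelEdge_eq_of_add (h.isPoint ho hox.symm).2.2.1 (h.isPoint ho hoy.symm).2.2.1
    (h.isPoint ho hzo).2.2.1 hedge ha hb ha' hb' hab hab'
  obtain ⟨c, d, hcd⟩ := (h.not_indep_iff hzu hzo.symm huo.symm).1
    ((h.apex_not_indep_iff ho hzo huo hzu).2 he)
  refine (h.not_indep_iff hxy hox hoy).2 ⟨c * a + d * a', c * b + d * b', ?_⟩ hind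
  rw [← hcd, ← hab, ← hab']
  module

/-- An element that lies on the long line through the apex of an edge has that edge. -/
theorem labelEdge_eq_of_isHub (h : IsLabelling w r M lab) {o e : α} (ho : lab o = apexLabel)
    (he : IsHub M e) (heo : e ≠ o) {a b : ℕ} (ha : a < r) (hb : b < r) (hab : a ≠ b)
    (hw : 2 ≤ w a + w b) : labelEdge (lab e) = s(a, b) := by
  obtain ⟨t, t₁, t₂, ht, ht₁, ht₂, h1, h2, h3, e1, e2, e3⟩ : ∃ t t₁ t₂ : ℕ × ℕ × ℕ,
      IsPointLabel w r t ∧ IsPointLabel w r t₁ ∧ IsPointLabel w r t₂ ∧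
      t ≠ t₁ ∧ t₂ ≠ t ∧ t₂ ≠ t₁ ∧
      labelEdge t = s(a, b) ∧ labelEdge t₁ = s(a, b) ∧ labelEdge t₂ = s(a, b) := by
    -- One point has `k = 0`, in the admissible orientation. The two others have `k ≥ 1`: they use
    -- one orientation if its weight is at least 2, and both if the two weights are 1.
    obtain ⟨z, hz, ez, kz⟩ : ∃ z, IsPointLabel w r z ∧ labelEdge z = s(a, b) ∧ z.2.2 = 0 := by
      by_cases hc : b = 0 ∨ a ≠ 0 ∧ a < b
      · exact ⟨(a, b, 0), by simp only [IsPointLabel]; omega, rfl, rfl⟩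
      · exact ⟨(b, a, 0), by simp only [IsPointLabel]; omega, Sym2.eq_swap, rfl⟩
    have hzk : ∀ (c d k : ℕ), k ≠ 0 → z ≠ (c, d, k) := by
      rintro c d k hk rfl
      exact hk kz
    have hpt : ∀ {c d k : ℕ}, c < r → d < r → c ≠ d → k ≠ 0 → k ≤ w c →
        IsPointLabel w r (c, d, k) := by
      intro c d k h1 h2 h3 h4 h5
      exact ⟨h1, h2, h3, h5, fun h => absurd h h4⟩
    by_cases hwa : 2 ≤ w a
    · exact ⟨(a, b, 1), (a, b, 2), z, hpt ha hb hab (by simp) (by omega),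
        hpt ha hb hab (by simp) hwa, hz, by simp, hzk _ _ _ (by simp), hzk _ _ _ (by simp),
        rfl, rfl, ez⟩
    by_cases hwb : 2 ≤ w b
    · exact ⟨(b, a, 1), (b, a, 2), z, hpt hb ha hab.symm (by simp) (by omega),
        hpt hb ha hab.symm (by simp) hwb, hz, by simp, hzk _ _ _ (by simp), hzk _ _ _ (by simp),
        Sym2.eq_swap, Sym2.eq_swap, ez⟩
    · exact ⟨(a, b, 1), (b, a, 1), z, hpt ha hb hab (by simp) (by omega),
        hpt hb ha hab.symm (by simp) (by omega), hz, by simp [hab], hzk _ _ _ (by simp),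
        hzk _ _ _ (by simp), rfl, Sym2.eq_swap, ez⟩
  obtain ⟨x, rfl⟩ := (h.range t).2 (Or.inr ht)
  obtain ⟨y, rfl⟩ := (h.range t₁).2 (Or.inr ht₁)
  obtain ⟨z, rfl⟩ := (h.range t₂).2 (Or.inr ht₂)
  have hno : ∀ x, IsPointLabel w r (lab x) → x ≠ o := fun _ => ne_of_isPointLabel ho
  have hxy : x ≠ y := fun hn => h1 (congrArg lab hn)
  have hzx : z ≠ x := fun hn => h2 (congrArg lab hn)
  have hzy : z ≠ y := fun hn => h3 (congrArg lab hn)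
  have hline : ¬ M.Indep {o, x, y} :=
    (h.apex_not_indep_iff ho (hno x ht) (hno y ht₁) hxy).2 (e1.trans e2.symm)
  obtain ⟨c, d, hcd⟩ := (h.not_indep_iff hxy (hno x ht).symm (hno y ht₁).symm).1 hline
  have hedge : ∀ z, z ≠ o → z ≠ x → z ≠ y → (¬ M.Indep {z, x, y} ↔
      labelEdge (lab z) = s(a, b)) := by
    intro z hzo hzx hzy
    obtain ⟨p, hp⟩ : ∃ p : ℝ, p • (labelVec (lab x)).1 = (labelVec (lab y)).1 := by
      have he := e1.trans e2.symm
      rw [labelEdge, labelEdge, Sym2.eq_iff] at he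
      rcases he with ⟨h1, h2⟩ | ⟨h1, h2⟩
      · exact ⟨1, by simp [labelVec, h1, h2]⟩
      · exact ⟨-1, by ext t; simp [labelVec, h1, h2]⟩
    rw [h.not_indep_iff hxy hzx hzy]
    constructor
    · rintro ⟨c, d, hcd⟩
      rw [← e1]
      refine (labelEdge_eq_of_smul (h.isPoint ho hzo).2.2.1 (c := c + d * p) ?_).symm
      rw [← hcd, Prod.fst_add, Prod.smul_fst, Prod.smul_fst, ← hp]
      module
    -- The apex is a combination of `x, y` and also of `x, z`; equating the two expressions and
    -- solving for `z` puts it on the line of `x` and `y`.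
    · intro hz
      obtain ⟨c', d', hcd'⟩ := (h.not_indep_iff hzx.symm (hno x ht).symm hzo.symm).1
        ((h.apex_not_indep_iff ho (hno x ht) hzo hzx.symm).2 (e1.trans hz.symm))
      have hd' : d' ≠ 0 := by
        rintro rfl
        rw [zero_smul, add_zero] at hcd'
        exact h.smul_ne (hno x ht) c' hcd'
      refine ⟨d'⁻¹ * (c - c'), d'⁻¹ * d, ?_⟩
      have h5 : d' • labelVec (lab z) =
          (c - c') • labelVec (lab x) + d • labelVec (lab y) := by
        rw [eq_comm, ← sub_eq_zero, ← sub_eq_zero.2 (hcd.trans hcd'.symm)]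
        module
      rw [mul_smul, mul_smul, ← smul_add, ← h5, smul_smul, inv_mul_cancel₀ hd', one_smul]
  have hzo := hno z ht₂
  rcases eq_or_ne e x with rfl | hex
  · exact e1
  rcases eq_or_ne e y with rfl | hey
  · exact e2
  have := he x y z o hxy hzx hzy (hno x ht).symm (hno y ht₁).symm hzo
    ((hedge z hzo hzx hzy).2 e3) hline
  exact (hedge e heo hex hey).1 ((this.resolve_left hex).resolve_left hey)

end IsLabelling

/-! ### Counting elements on the lines through the apex -/

/-- The point labels with the edge `{a, b}`, for `a < b`. -/
def fiberLabels (w : ℕ → ℕ) (a b : ℕ) : Finset (ℕ × ℕ × ℕ) :=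
  (Finset.Icc (if a = 0 then 1 else 0) (w a)).image (fun k => (a, b, k)) ∪
    (Finset.Icc (if a = 0 then 0 else 1) (w b)).image fun k => (b, a, k)

theorem mem_fiberLabels {w : ℕ → ℕ} {r a b : ℕ} (hab : a < b) (hb : b < r) (t : ℕ × ℕ × ℕ) :
    t ∈ fiberLabels w a b ↔ IsPointLabel w r t ∧ labelEdge t = s(a, b) := by
  obtain ⟨c, d, k⟩ := t
  simp only [fiberLabels, Finset.mem_union, Finset.mem_image, Finset.mem_Icc, Prod.mk.injEq,
    IsPointLabel, labelEdge, Sym2.eq_iff]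
  constructor
  · rintro (⟨k', hk, rfl, rfl, rfl⟩ | ⟨k', hk, rfl, rfl, rfl⟩) <;> split_ifs at hk <;> omega
  · rintro ⟨h, ⟨rfl, rfl⟩ | ⟨rfl, rfl⟩⟩
    · exact Or.inl ⟨k, by split_ifs <;> omega, rfl, rfl, rfl⟩
    · exact Or.inr ⟨k, by split_ifs <;> omega, rfl, rfl, rfl⟩

/-- The positive `k` contribute `w a` and `w b`; the two orientations share a single point with `k =
0`, which is `(b, 0, 0)` if `a = 0` and `(a, b, 0)` otherwise. -/
theorem card_fiberLabels (w : ℕ → ℕ) {a b : ℕ} (hab : a < b) :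
    (fiberLabels w a b).card = w a + w b + 1 := by
  rw [fiberLabels, Finset.card_union_of_disjoint, Finset.card_image_of_injective,
    Finset.card_image_of_injective, Nat.card_Icc, Nat.card_Icc]
  · split_ifs <;> omega
  · intro k l hkl
    simpa using hkl
  · intro k l hkl
    simpa using hkl
  · rw [Finset.disjoint_left]
    rintro ⟨c, d, k⟩ h1 h2
    simp only [Finset.mem_image, Prod.mk.injEq] at h1 h2
    obtain ⟨_, _, h1⟩ := h1
    obtain ⟨_, _, h2⟩ := h2
    omega

/-- The elements other than `o` on the line through `o` and `x`. -/
def lineThrough {α : Type*} (M : Matroid α) (o x : α) : Set α :=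
  {y | y ≠ o ∧ (y = x ∨ ¬ M.Indep {o, x, y})}

/-- The elements on the lines through `o` with exactly `s + 1` elements other than `o`. -/
def linesOfLength {α : Type*} (M : Matroid α) (o : α) (s : ℕ) : Set α :=
  {x | x ≠ o ∧ (lineThrough M o x).ncard = s + 1}

namespace IsLabelling

variable {α : Type*} {w : ℕ → ℕ} {r : ℕ} {M : Matroid α} {lab : α → ℕ × ℕ × ℕ}

theorem exists_edge (h : IsLabelling w r M lab) {o x : α} (ho : lab o = apexLabel) (hx : x ≠ o) :
    ∃ a b, a < b ∧ b < r ∧ labelEdge (lab x) = s(a, b) := by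
  have hp := h.isPoint ho hx
  rcases lt_or_gt_of_ne hp.2.2.1 with hlt | hlt
  · exact ⟨_, _, hlt, hp.2.1, rfl⟩
  · exact ⟨_, _, hlt, hp.1, Sym2.eq_swap⟩

theorem image_lineThrough (h : IsLabelling w r M lab) {o x : α} (ho : lab o = apexLabel)
    (hx : x ≠ o) {a b : ℕ} (hab : a < b) (hb : b < r) (he : labelEdge (lab x) = s(a, b)) :
    lab '' lineThrough M o x = (fiberLabels w a b : Set (ℕ × ℕ × ℕ)) := by
  ext t
  rw [Finset.mem_coe, mem_fiberLabels hab hb]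
  constructor
  · rintro ⟨y, ⟨hy, hxy⟩, rfl⟩
    refine ⟨h.isPoint ho hy, ?_⟩
    by_cases hyx : y = x
    · rw [hyx, he]
    · rw [← he, ← (h.apex_not_indep_iff ho hx hy (Ne.symm hyx)).1 (hxy.resolve_left hyx)]
  · rintro ⟨ht, hte⟩
    obtain ⟨y, rfl⟩ := (h.range t).2 (Or.inr ht)
    have hy := ne_of_isPointLabel ho ht
    refine ⟨y, ⟨hy, ?_⟩, rfl⟩
    by_cases hyx : y = x
    · exact Or.inl hyx
    · exact Or.inr ((h.apex_not_indep_iff ho hx hy (Ne.symm hyx)).2 (he.trans hte.symm))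

theorem ncard_lineThrough (h : IsLabelling w r M lab) {o x : α} (ho : lab o = apexLabel)
    (hx : x ≠ o) {a b : ℕ} (hab : a < b) (hb : b < r) (he : labelEdge (lab x) = s(a, b)) :
    (lineThrough M o x).ncard = w a + w b + 1 := by
  rw [← Set.ncard_image_of_injective _ h.inj, h.image_lineThrough ho hx hab hb he,
    Set.ncard_coe_finset, card_fiberLabels w hab]

/-- Lines are counted through their elements: each pair of sum `s` contributes `s + 1` of them, and
different pairs contribute disjoint sets. -/
theorem ncard_linesOfLength (h : IsLabelling w r M lab) {o : α} (ho : lab o = apexLabel) (s : ℕ) :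
    (linesOfLength M o s).ncard = (pairsWithSum w r s).card * (s + 1) := by
  have himage : lab '' linesOfLength M o s =
      ((pairsWithSum w r s).biUnion fun p => fiberLabels w p.1 p.2 : Finset (ℕ × ℕ × ℕ)) := by
    ext t
    rw [Finset.mem_coe, Finset.mem_biUnion]
    constructor
    · rintro ⟨x, ⟨hx, hs⟩, rfl⟩
      obtain ⟨a, b, hab, hb, he⟩ := h.exists_edge ho hx
      rw [h.ncard_lineThrough ho hx hab hb he] at hs
      refine ⟨(a, b), ?_, (mem_fiberLabels hab hb _).2 ⟨h.isPoint ho hx, he⟩⟩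
      simp only [pairsWithSum, Finset.mem_filter, Finset.mem_product, Finset.mem_range]
      omega
    · rintro ⟨⟨a, b⟩, hp, ht⟩
      simp only [pairsWithSum, Finset.mem_filter, Finset.mem_product, Finset.mem_range] at hp
      obtain ⟨⟨ha, hb⟩, hab, hs⟩ := hp
      obtain ⟨hpt, he⟩ := (mem_fiberLabels hab hb _).1 ht
      obtain ⟨x, rfl⟩ := (h.range t).2 (Or.inr hpt)
      have hx := ne_of_isPointLabel ho hpt
      exact ⟨x, ⟨hx, by rw [h.ncard_lineThrough ho hx hab hb he, hs]⟩, rfl⟩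
  rw [← Set.ncard_image_of_injective _ h.inj, himage, Set.ncard_coe_finset, Finset.card_biUnion]
  · refine Finset.sum_const_nat fun p hp => ?_
    simp only [pairsWithSum, Finset.mem_filter] at hp
    rw [card_fiberLabels w hp.2.1, hp.2.2]
  · rintro ⟨a, b⟩ hp ⟨c, d⟩ hq hpq
    simp only [pairsWithSum, Finset.mem_coe, Finset.mem_filter, Finset.mem_product, Finset.mem_range] at hp hq
    rw [Function.onFun, Finset.disjoint_left]
    intro t h1 h2
    have e1 := ((mem_fiberLabels hp.2.1 hp.1.2 t).1 h1).2
    have e2 := ((mem_fiberLabels hq.2.1 hq.1.2 t).1 h2).2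
    rw [e1, Sym2.eq_iff] at e2
    refine hpq ?_
    rw [Prod.mk.injEq]
    omega

end IsLabelling

/-! ### Transport along an isomorphism -/

section Isomorphism

variable {α β : Type*} {M : Matroid α} {N : Matroid β}

theorem MatroidIsomorphic.exists_equiv (hM : M.E = Set.univ) (hN : N.E = Set.univ)
    (h : MatroidIsomorphic M N) : ∃ f : α ≃ β, ∀ I, M.Indep I ↔ N.Indep (f '' I) := by
  obtain ⟨φ, hφ⟩ := h
  let g : α ≃ M.E := (Equiv.Set.univ α).symm.trans (Equiv.setCongr hM.symm)
  let g' : N.E ≃ β := (Equiv.setCongr hN).trans (Equiv.Set.univ β)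
  refine ⟨(g.trans φ).trans g', fun I => ?_⟩
  have h1 := hφ (g '' I)
  rw [Set.image_image, Set.image_image, Set.image_image] at h1
  have h2 : (fun x => ((g x : M.E) : α)) '' I = I := by
    rw [show (fun x => ((g x : M.E) : α)) = id from rfl, Set.image_id]
  rw [h2] at h1
  exact h1

variable {f : α ≃ β}

theorem indep_triple_iff (hf : ∀ I, M.Indep I ↔ N.Indep (f '' I)) (x y z : α) :
    N.Indep {f x, f y, f z} ↔ M.Indep {x, y, z} := by
  rw [hf, Set.image_insert_eq, Set.image_pair]

theorem IsHub.map (hf : ∀ I, M.Indep I ↔ N.Indep (f '' I)) {e : α} (he : IsHub M e) :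
    IsHub N (f e) := by
  intro x y z u
  obtain ⟨x, rfl⟩ := f.surjective x
  obtain ⟨y, rfl⟩ := f.surjective y
  obtain ⟨z, rfl⟩ := f.surjective z
  obtain ⟨u, rfl⟩ := f.surjective u
  simp only [indep_triple_iff hf, ne_eq, f.injective.eq_iff]
  exact he x y z u

theorem lineThrough_map (hf : ∀ I, M.Indep I ↔ N.Indep (f '' I)) (o x : α) :
    lineThrough N (f o) (f x) = f '' lineThrough M o x := by
  ext y
  obtain ⟨y, rfl⟩ := f.surjective y
  rw [f.injective.mem_set_image]
  simp only [lineThrough, Set.mem_ofPred_eq, indep_triple_iff hf, ne_eq, f.injective.eq_iff]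

theorem linesOfLength_map (hf : ∀ I, M.Indep I ↔ N.Indep (f '' I)) (o : α) (s : ℕ) :
    linesOfLength N (f o) s = f '' linesOfLength M o s := by
  ext x
  obtain ⟨x, rfl⟩ := f.surjective x
  rw [f.injective.mem_set_image]
  simp only [linesOfLength, Set.mem_ofPred_eq, lineThrough_map hf, ne_eq, f.injective.eq_iff,
    Set.ncard_image_of_injective _ f.injective]

/-- If two labelled matroids are isomorphic, then their weights agree up to order. -/
theorem IsLabelling.card_filter_eq {w w' : ℕ → ℕ} {r : ℕ} {lab : α → ℕ × ℕ × ℕ}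
    {lab' : β → ℕ × ℕ × ℕ} (h : IsLabelling w r M lab) (h' : IsLabelling w' r N lab')
    (hM : M.E = Set.univ) (hN : N.E = Set.univ) (hMN : MatroidIsomorphic M N)
    (hw : ∃ a < r, w a = 0) (hw' : ∃ a < r, w' a = 0)
    (hlong : ∃ a b c d, a < r ∧ b < r ∧ c < r ∧ d < r ∧ a ≠ b ∧ c ≠ d ∧ s(a, b) ≠ s(c, d) ∧
      2 ≤ w' a + w' b ∧ 2 ≤ w' c + w' d) (s : ℕ) :
    ((Finset.range r).filter fun a => w a = s).card =
      ((Finset.range r).filter fun a => w' a = s).card := by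
  obtain ⟨f, hf⟩ := hMN.exists_equiv hM hN
  obtain ⟨o, ho⟩ := (h.range apexLabel).2 (Or.inl rfl)
  obtain ⟨o', ho'⟩ := (h'.range apexLabel).2 (Or.inl rfl)
  -- Otherwise the image of the apex is a hub different from `o'`, and it would have two different
  -- edges.
  have hfo : f o = o' := by
    by_contra hne
    obtain ⟨a, b, c, d, ha, hb, hc, hd, hab, hcd, hneq, h1, h2⟩ := hlong
    have hub := (h.isHub_apex ho).map hf
    exact hneq ((h'.labelEdge_eq_of_isHub ho' hub hne ha hb hab h1).symm.trans
      (h'.labelEdge_eq_of_isHub ho' hub hne hc hd hcd h2))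
  refine card_filter_eq_of_pairsWithSum hw hw' (fun s => ?_) s
  have hs := h'.ncard_linesOfLength ho' s
  rw [← hfo, linesOfLength_map hf, Set.ncard_image_of_injective _ f.injective,
    h.ncard_linesOfLength ho s] at hs
  exact Nat.eq_of_mul_eq_mul_right (Nat.succ_pos s) hs

end Isomorphism

/-! ### Labelling the columns of the two matrices -/

/-- The label of a unit vector. -/
def unitLabel (i : ℕ) : ℕ × ℕ × ℕ := if i = 0 then apexLabel else (i, 0, 0)

/-- The linear map that sends the unit vectors to the vectors of their labels. -/
noncomputable def unitLift (r : ℕ) : (Fin r → ℝ) →ₗ[ℝ] (ℕ → ℝ) × ℝ :=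
  Fintype.linearCombination ℝ fun i : Fin r => labelVec (unitLabel i)

/-- Coordinate `i ≠ 0` of the first factor reads off `t i`, since `δ_i` occurs in the image of one
unit vector only; the second factor reads off `t 0`. -/
theorem unitLift_injective (r : ℕ) : Function.Injective (unitLift r) := by
  rw [← LinearMap.ker_eq_bot, LinearMap.ker_eq_bot']
  intro t ht
  rw [unitLift, Fintype.linearCombination_apply] at ht
  have h1 : ∀ i : Fin r, (i : ℕ) ≠ 0 → t i = 0 := by
    intro i hi
    have := congrFun (congrArg Prod.fst ht) i
    rw [Prod.fst_sum, Finset.sum_apply, Finset.sum_eq_single i] at this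
    · simpa [unitLabel, labelVec, hi] using this
    · intro j _ hj
      have hj' : (i : ℕ) ≠ j := fun h => hj (Fin.ext h.symm)
      by_cases h0 : (j : ℕ) = 0 <;> simp [unitLabel, labelVec, hi, h0, hj']
    · simp
  funext i
  by_cases hi : (i : ℕ) = 0
  · have := congrArg Prod.snd ht
    rw [Prod.snd_sum, Finset.sum_eq_single i] at this
    · simpa [unitLabel, labelVec, hi] using this
    · intro j _ hj
      have hj' : (j : ℕ) ≠ 0 := fun h => hj (Fin.ext (h.trans hi.symm))
      simp [unitLabel, labelVec, hj']
    · simp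
  · exact h1 i hi

/-- The restriction of `unitLift` to integer vectors. -/
noncomputable def intLift (r : ℕ) : (Fin r → ℤ) →+ (ℕ → ℝ) × ℝ :=
  (unitLift r).toAddMonoidHom.comp ((Int.castAddHom ℝ).compLeft (Fin r))

theorem intLift_stdVec {r i : ℕ} (hi : i < r) :
    intLift r (stdVec r i) = labelVec (unitLabel i) := by
  have h : (Int.castAddHom ℝ).compLeft (Fin r) (stdVec r i) = Pi.single (⟨i, hi⟩ : Fin r) 1 := by
    funext t
    by_cases ht : (t : ℕ) = i
    · have : t = ⟨i, hi⟩ := Fin.ext ht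
      subst this
      simp [stdVec]
    · have : t ≠ ⟨i, hi⟩ := fun hn => ht (congrArg Fin.val hn)
      simp [stdVec, ht, this]
  change unitLift r ((Int.castAddHom ℝ).compLeft (Fin r) (stdVec r i)) = _
  rw [h, unitLift, Fintype.linearCombination_apply_single, one_smul]

theorem integerVectorMatroid_ground {m n : Type*} [Finite n] (A : Matrix m n ℤ) :
    (integerVectorMatroid A).E = Set.univ := rfl

theorem isLabelling_of_intLift {ι : Type*} [Finite ι] {w : ℕ → ℕ} {r : ℕ}
    (A : Matrix (Fin r) ι ℤ) {lab : ι → ℕ × ℕ × ℕ} (inj : Function.Injective lab)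
    (range : ∀ t, (∃ x, lab x = t) ↔ t = apexLabel ∨ IsPointLabel w r t)
    (h : ∀ c, intLift r (fun t => A t c) = labelVec (lab c)) :
    IsLabelling w r (integerVectorMatroid A) lab where
  inj := inj
  range := range
  indep I := by
    rw [integerVectorMatroid, vectorMatroid_indep,
      ← (unitLift r).linearIndepOn_iff_of_injOn (unitLift_injective r).injOn]
    have : (unitLift r) ∘ (A.map (Int.cast : ℤ → ℝ)).col = fun x => labelVec (lab x) := by
      funext c
      rw [← h]
      rfl
    rw [this]

/-- The labels of the columns `e_i` and `e_i - e_j`. -/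
def cliqueLabel (r : ℕ) : CliqueIdx r → ℕ × ℕ × ℕ
  | .inl i => unitLabel i
  | .inr p => if (p.1.1 : ℕ) = 0 then (0, p.1.2, 1) else (p.1.1, p.1.2, 0)

theorem intLift_cliqueCol {r : ℕ} (c : CliqueIdx r) :
    intLift r (cliqueCol r c) = labelVec (cliqueLabel r c) := by
  rcases c with i | ⟨⟨i, j⟩, hij⟩
  · exact intLift_stdVec i.2
  · have hj : (j : ℕ) ≠ 0 := by
      have : (i : ℕ) < j := hij
      omega
    simp only [cliqueCol, cliqueLabel, map_sub, intLift_stdVec i.2, intLift_stdVec j.2]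
    by_cases hi : (i : ℕ) = 0
    · ext <;> simp [unitLabel, labelVec, hi, hj]
    · ext <;> simp [unitLabel, labelVec, hi, hj]

theorem cliqueLabel_injective (r : ℕ) : Function.Injective (cliqueLabel r) := by
  rintro (i | ⟨⟨i, j⟩, hij⟩) (i' | ⟨⟨i', j'⟩, hij'⟩) h <;>
    simp only [cliqueLabel, unitLabel] at h
  · congr 1
    apply Fin.ext
    split_ifs at h <;> simp only [Prod.mk.injEq] at h <;> omega
  · have : (i' : ℕ) < j' := hij'
    exfalso
    split_ifs at h <;> simp only [Prod.mk.injEq] at h <;> omega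
  · have : (i : ℕ) < j := hij
    exfalso
    split_ifs at h <;> simp only [Prod.mk.injEq] at h <;> omega
  · have h' : (i : ℕ) = i' ∧ (j : ℕ) = j' := by
      split_ifs at h <;> simp only [Prod.mk.injEq] at h <;> omega
    obtain rfl := Fin.ext h'.1
    obtain rfl := Fin.ext h'.2
    rfl

/-- The columns `e_0 - e_j` become `(0, j, 1)`, so the clique already gives vertex 0 weight 1; all
other clique columns except the apex have `k = 0`. -/
theorem exists_cliqueLabel_eq {r : ℕ} (hr : 0 < r) (a b k : ℕ) :
    (∃ c, cliqueLabel r c = (a, b, k)) ↔ (a = 0 ∧ b = 0 ∧ k = 1) ∨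
      (a < r ∧ b < r ∧ a ≠ b ∧ (k = 0 ∧ (b = 0 ∨ a ≠ 0 ∧ a < b) ∨ k = 1 ∧ a = 0)) := by
  constructor
  · rintro ⟨i | ⟨⟨i, j⟩, hij⟩, h⟩
    · have := i.2
      simp only [cliqueLabel, unitLabel] at h
      split_ifs at h <;> simp only [Prod.mk.injEq] at h <;> omega
    · have h1 : (i : ℕ) < j := hij
      have h2 := j.2
      simp only [cliqueLabel] at h
      split_ifs at h <;> simp only [Prod.mk.injEq] at h <;> omega
  · rintro (⟨rfl, rfl, rfl⟩ | ⟨ha, hb, hab, ⟨rfl, h⟩ | ⟨rfl, rfl⟩⟩)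
    · exact ⟨.inl ⟨0, hr⟩, rfl⟩
    · by_cases hb0 : b = 0
      · subst hb0
        exact ⟨.inl ⟨a, ha⟩, if_neg hab⟩
      · exact ⟨.inr ⟨(⟨a, ha⟩, ⟨b, hb⟩), Fin.mk_lt_mk.2 (by omega)⟩, if_neg (by dsimp only; omega)⟩
    · exact ⟨.inr ⟨(⟨0, ha⟩, ⟨b, hb⟩), Fin.mk_lt_mk.2 (by omega)⟩, rfl⟩

/-- The labels of the columns `k e_1 + e_{i+1}` and `k e_1 + e_{i+1} - e_j`. -/
def partitionLabel {m : ℕ} (s : Fin m → ℕ) (r : ℕ) : PartitionIdx s r → ℕ × ℕ × ℕ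
  | .inl ⟨i, k⟩ => (i + 1, 0, k + 1)
  | .inr ⟨(⟨i, k⟩, j), _⟩ => (i + 1, j, k + 1)

/-- The weights `1, s 0, s 1, …, 0, 0, …`. -/
def seqWeight {m : ℕ} (s : Fin m → ℕ) : ℕ → ℕ
  | 0 => 1
  | a + 1 => if h : a < m then s ⟨a, h⟩ else 0

theorem intLift_partitionCol {m r : ℕ} (s : Fin m → ℕ) (hr : m + 1 ≤ r) (c : PartitionIdx s r) :
    intLift r (partitionCol s r c) = labelVec (partitionLabel s r c) := by
  rcases c with ⟨i, k⟩ | ⟨⟨⟨i, k⟩, j⟩, hj⟩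
  · have hi : (i : ℕ) + 1 < r := by omega
    simp only [partitionCol, partitionLabel, map_add, map_zsmul, intLift_stdVec hi,
      intLift_stdVec (show 0 < r by omega)]
    ext <;> simp [unitLabel, labelVec]
  · have hi : (i : ℕ) + 1 < r := by omega
    simp only at hj
    simp only [partitionCol, partitionLabel, map_add, map_sub, map_zsmul, intLift_stdVec hi,
      intLift_stdVec j.2, intLift_stdVec (show 0 < r by omega)]
    ext <;> simp [unitLabel, labelVec, hj.1]

theorem partitionLabel_injective {m : ℕ} (s : Fin m → ℕ) (r : ℕ) :
    Function.Injective (partitionLabel s r) := by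
  rintro (⟨i, k⟩ | ⟨⟨⟨i, k⟩, j⟩, hj⟩) (⟨i', k'⟩ | ⟨⟨⟨i', k'⟩, j'⟩, hj'⟩) h <;>
    simp only [partitionLabel, Prod.mk.injEq] at h
  · obtain rfl : i = i' := Fin.ext (by omega)
    obtain rfl : k = k' := Fin.ext (by omega)
    rfl
  · exact absurd h.2.1.symm hj'.1
  · exact absurd h.2.1 hj.1
  · obtain rfl : i = i' := Fin.ext (by omega)
    obtain rfl : k = k' := Fin.ext (by omega)
    obtain rfl : j = j' := Fin.ext h.2.1
    rfl

theorem exists_partitionLabel_eq {m r : ℕ} (s : Fin m → ℕ) (hr : m + 1 ≤ r) (a b k : ℕ) :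
    (∃ c, partitionLabel s r c = (a, b, k)) ↔
      a < r ∧ b < r ∧ a ≠ b ∧ k ≤ seqWeight s a ∧ a ≠ 0 ∧ k ≠ 0 := by
  constructor
  · rintro ⟨⟨i, k⟩ | ⟨⟨⟨i, k⟩, j⟩, hj⟩, h⟩ <;> simp only [partitionLabel, Prod.mk.injEq] at h <;>
      obtain ⟨rfl, rfl, rfl⟩ := h <;> simp only [seqWeight, dif_pos i.2] <;>
      have hk : (k : ℕ) < s i := k.2
    · refine ⟨?_, ?_, ?_, hk, ?_, ?_⟩ <;> omega
    · have := hj.2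
      dsimp only at this
      refine ⟨?_, ?_, ?_, hk, ?_, ?_⟩ <;> omega
  · rintro ⟨ha, hb, hab, hk, ha0, hk0⟩
    obtain ⟨a, rfl⟩ := Nat.exists_eq_succ_of_ne_zero ha0
    obtain ⟨k, rfl⟩ := Nat.exists_eq_succ_of_ne_zero hk0
    simp only [Nat.succ_eq_add_one, seqWeight] at *
    split_ifs at hk with ham
    · by_cases hb0 : b = 0
      · subst hb0
        exact ⟨.inl ⟨⟨a, ham⟩, ⟨k, hk⟩⟩, rfl⟩
      · exact ⟨.inr ⟨(⟨⟨a, ham⟩, ⟨k, hk⟩⟩, ⟨b, hb⟩), hb0, hab.symm⟩, rfl⟩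
    · omega

theorem isLabelling_matrixAPartition {Δ r : ℕ} (lam : (Δ - 1).Partition)
    (hr : (lam.parts.sort (· ≥ ·)).length + 1 ≤ r) :
    IsLabelling (seqWeight (partitionSeq lam)) r (integerVectorMatroid (matrixAPartition Δ lam r))
      (Sum.elim (cliqueLabel r) (partitionLabel (partitionSeq lam) r)) := by
  refine isLabelling_of_intLift _ ?_ ?_ ?_
  · refine (cliqueLabel_injective r).sumElim (partitionLabel_injective _ r) fun c d hcd => ?_
    rcases hlab : cliqueLabel r c with ⟨a, b, k⟩
    have h1 := (exists_cliqueLabel_eq (by omega) a b k).1 ⟨c, hlab⟩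
    have h2 := (exists_partitionLabel_eq _ hr a b k).1 ⟨d, hcd.symm.trans hlab⟩
    omega
  · rintro ⟨a, b, k⟩
    rw [Sum.exists]
    simp only [Sum.elim_inl, Sum.elim_inr]
    rw [exists_cliqueLabel_eq (by omega), exists_partitionLabel_eq _ hr]
    simp only [IsPointLabel, Prod.mk.injEq]
    have h0 : seqWeight (partitionSeq lam) 0 = 1 := rfl
    rcases Nat.eq_zero_or_pos a with rfl | ha
    · rw [h0]; omega
    · omega
  · rintro (c | c)
    · exact intLift_cliqueCol c
    · exact intLift_partitionCol _ hr c

/-- The labels of the columns `k e_1 - e_i`. -/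
def lastLabel (Δ r : ℕ) (q : LastIdx Δ r) : ℕ × ℕ × ℕ := (0, q.1.1, q.2.1)

theorem isLabelling_matrixA {Δ r : ℕ} (hΔ : 1 ≤ Δ) (hr : 0 < r) :
    IsLabelling (fun a => if a = 0 then Δ else 0) r (integerVectorMatroid (matrixA Δ r))
      (Sum.elim (cliqueLabel r) (lastLabel Δ r)) := by
  have hlast : ∀ a b k : ℕ, (∃ c, lastLabel Δ r c = (a, b, k)) ↔
      a = 0 ∧ b ≠ 0 ∧ b < r ∧ 2 ≤ k ∧ k ≤ Δ := by
    intro a b k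
    constructor
    · rintro ⟨⟨⟨i, hi⟩, ⟨k, hk⟩⟩, h⟩
      rw [Finset.mem_Icc] at hk
      simp only [lastLabel, Prod.mk.injEq] at h
      omega
    · rintro ⟨rfl, hb0, hb, hk⟩
      exact ⟨⟨⟨⟨b, hb⟩, hb0⟩, ⟨k, Finset.mem_Icc.2 hk⟩⟩, rfl⟩
  refine isLabelling_of_intLift _ ?_ ?_ ?_
  · refine (cliqueLabel_injective r).sumElim ?_ fun c d hcd => ?_
    · rintro ⟨⟨i, hi⟩, ⟨k, hk⟩⟩ ⟨⟨i', hi'⟩, ⟨k', hk'⟩⟩ h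
      simp only [lastLabel, Prod.mk.injEq, true_and] at h
      obtain rfl := Fin.ext h.1
      obtain rfl := h.2
      rfl
    · rcases hlab : cliqueLabel r c with ⟨a, b, k⟩
      have h1 := (exists_cliqueLabel_eq hr a b k).1 ⟨c, hlab⟩
      have h2 := (hlast a b k).1 ⟨d, hcd.symm.trans hlab⟩
      omega
  · rintro ⟨a, b, k⟩
    rw [Sum.exists]
    simp only [Sum.elim_inl, Sum.elim_inr]
    rw [exists_cliqueLabel_eq hr, hlast]
    simp only [IsPointLabel, Prod.mk.injEq]
    split_ifs <;> omega
  · rintro (c | ⟨⟨i, hi⟩, ⟨k, hk⟩⟩)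
    · exact intLift_cliqueCol c
    · change intLift r ((k : ℤ) • stdVec r 0 - stdVec r i) = labelVec (0, (i : ℕ), k)
      rw [map_sub, map_zsmul, intLift_stdVec hr, intLift_stdVec i.2]
      ext <;> simp [unitLabel, labelVec, hi]

/-! ### The weights of a partition -/

theorem sum_range_getD_eq_count {s : ℕ} (hs : s ≠ 0) (l : List ℕ) {n : ℕ} (h : l.length ≤ n) :
    (∑ a ∈ Finset.range n, if l.getD a 0 = s then 1 else 0) = l.count s := by
  induction l generalizing n with
  | nil => simp [hs.symm]
  | cons b l ih =>
    obtain ⟨n, rfl⟩ := Nat.exists_eq_succ_of_ne_zero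
      (show n ≠ 0 by rw [List.length_cons] at h; omega)
    rw [Finset.sum_range_succ', List.count_cons]
    simp only [List.getD_cons_succ, List.getD_cons_zero, beq_iff_eq]
    rw [ih (by simpa using h)]

theorem seqWeight_partitionSeq_succ {n : ℕ} (lam : n.Partition) (a : ℕ) :
    seqWeight (partitionSeq lam) (a + 1) = (lam.parts.sort (· ≥ ·)).getD a 0 := by
  simp only [seqWeight, partitionSeq]
  split_ifs with h
  · rw [List.getD_eq_getElem _ _ h]; rfl
  · rw [List.getD_eq_default _ _ (by omega)]

/-- The extra summand is the weight 1 of vertex 0. The value `s = 0` is excluded because of the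
padding zeros. -/
theorem card_filter_seqWeight {n r s : ℕ} (lam : n.Partition) (hs : s ≠ 0)
    (hr : (lam.parts.sort (· ≥ ·)).length + 1 ≤ r) :
    ((Finset.range r).filter fun a => seqWeight (partitionSeq lam) a = s).card =
      lam.parts.count s + if 1 = s then 1 else 0 := by
  obtain ⟨r, rfl⟩ := Nat.exists_eq_succ_of_ne_zero (show r ≠ 0 by omega)
  rw [Finset.card_filter, Finset.sum_range_succ']
  simp only [seqWeight_partitionSeq_succ]
  rw [sum_range_getD_eq_count hs _ (by omega), ← Multiset.coe_count, Multiset.sort_eq]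
  rfl

theorem length_sort_parts_le {n : ℕ} (lam : n.Partition) :
    (lam.parts.sort (· ≥ ·)).length ≤ n := by
  rw [Multiset.length_sort]
  have h := Multiset.card_nsmul_le_sum (s := lam.parts) (a := 1) fun x hx => lam.parts_pos hx
  rw [lam.parts_sum] at h
  simpa using h

theorem exists_seqWeight_eq_zero {n r : ℕ} (lam : n.Partition) (hr : n + 2 ≤ r) :
    ∃ a < r, seqWeight (partitionSeq lam) a = 0 := by
  -- There are at most `n` parts, occupying positions `1` to `n` at most, so position `n + 1` is
  -- padding.
  refine ⟨n + 1, by omega, ?_⟩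
  rw [seqWeight_partitionSeq_succ, List.getD_eq_default _ _ (length_sort_parts_le lam)]

/-- The weights of a partition of `n ≥ 2` have two different pairs of sum at least `2`. -/
theorem exists_long_pairs {n r : ℕ} (lam : n.Partition) (hn : 2 ≤ n) (hr : 3 ≤ r) :
    ∃ a b c d, a < r ∧ b < r ∧ c < r ∧ d < r ∧ a ≠ b ∧ c ≠ d ∧ s(a, b) ≠ s(c, d) ∧
      2 ≤ seqWeight (partitionSeq lam) a + seqWeight (partitionSeq lam) b ∧
      2 ≤ seqWeight (partitionSeq lam) c + seqWeight (partitionSeq lam) d := by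
  have hpos : ∀ x ∈ lam.parts.sort (· ≥ ·), 0 < x := fun x hx =>
    lam.parts_pos ((Multiset.mem_sort _).1 hx)
  have hsum : (lam.parts.sort (· ≥ ·)).sum = n := by
    rw [← Multiset.sum_coe, Multiset.sort_eq, lam.parts_sum]
  have h0 : seqWeight (partitionSeq lam) 0 = 1 := rfl
  have h1 : seqWeight (partitionSeq lam) 1 = (lam.parts.sort (· ≥ ·)).getD 0 0 :=
    seqWeight_partitionSeq_succ lam 0
  have h2 : seqWeight (partitionSeq lam) 2 = (lam.parts.sort (· ≥ ·)).getD 1 0 :=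
    seqWeight_partitionSeq_succ lam 1
  generalize seqWeight (partitionSeq lam) = w at h0 h1 h2 ⊢
  generalize lam.parts.sort (· ≥ ·) = l at hpos hsum h1 h2
  rcases l with _ | ⟨x, _ | ⟨y, l⟩⟩
  · rw [List.sum_nil] at hsum
    omega
  · rw [List.sum_singleton] at hsum
    rw [List.getD_cons_zero] at h1
    -- A single part equals `n ≥ 2`, so every pair containing vertex 1 is long. For `n = 1` only
    -- `{0, 1}` would be.
    refine ⟨0, 1, 1, 2, by omega, by omega, by omega, by omega, by omega, by omega, ?_,
      by omega, by omega⟩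
    rw [ne_eq, Sym2.eq_iff]
    omega
  · have hx := hpos x (by simp)
    have hy := hpos y (by simp)
    rw [List.getD_cons_zero] at h1
    rw [List.getD_cons_succ, List.getD_cons_zero] at h2
    refine ⟨0, 1, 0, 2, by omega, by omega, by omega, by omega, by omega, by omega, ?_,
      by omega, by omega⟩
    rw [ne_eq, Sym2.eq_iff]
    omega

theorem mainTheorem4 (Δ r : ℕ) (hΔ : 2 ≤ Δ) (hr : Δ + 1 ≤ r) :
    (∀ lam lam' : (Δ - 1).Partition, lam ≠ lam' →
      ¬ MatroidIsomorphic (integerVectorMatroid (matrixAPartition Δ lam r))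
          (integerVectorMatroid (matrixAPartition Δ lam' r))) ∧
    (∀ lam : (Δ - 1).Partition,
      ¬ MatroidIsomorphic (integerVectorMatroid (matrixAPartition Δ lam r))
          (integerVectorMatroid (matrixA Δ r))) := by
  have hlen : ∀ lam : (Δ - 1).Partition, (lam.parts.sort (· ≥ ·)).length + 1 ≤ r := fun lam => by
    have := length_sort_parts_le lam
    omega
  refine ⟨fun lam lam' hne hiso => hne ?_, fun lam hiso => ?_⟩
  -- Here the weights are `1, 1, 0, …, 0`, with only one long line, so the apex need not be the only
  -- hub; but 1 has just one partition.
  · by_cases hΔ2 : Δ = 2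
    · subst hΔ2
      exact (inferInstance : Subsingleton (Nat.Partition 1)).elim lam lam'
    have key := (isLabelling_matrixAPartition lam (hlen lam)).card_filter_eq
      (isLabelling_matrixAPartition lam' (hlen lam'))
      (integerVectorMatroid_ground _) (integerVectorMatroid_ground _) hiso
      (exists_seqWeight_eq_zero lam (by omega)) (exists_seqWeight_eq_zero lam' (by omega))
      (exists_long_pairs lam' (by omega) (by omega))
    refine Nat.Partition.ext (Multiset.ext.2 fun s => ?_)
    rcases eq_or_ne s 0 with rfl | hs
    · rw [Multiset.count_eq_zero.2 fun h => (lam.parts_pos h).ne' rfl,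
        Multiset.count_eq_zero.2 fun h => (lam'.parts_pos h).ne' rfl]
    · have := key s
      rw [card_filter_seqWeight lam hs (hlen lam), card_filter_seqWeight lam' hs (hlen lam')] at this
      omega
  · have key := (isLabelling_matrixAPartition lam (hlen lam)).card_filter_eq
      (isLabelling_matrixA (by omega) (by omega))
      (integerVectorMatroid_ground _) (integerVectorMatroid_ground _) hiso
      (exists_seqWeight_eq_zero lam (by omega)) ⟨1, by omega, rfl⟩
      ⟨0, 1, 0, 2, by omega, by omega, by omega, by omega, by omega, by omega, by
        rw [ne_eq, Sym2.eq_iff]; omega, by simpa using hΔ, by simpa using hΔ⟩ 1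
    -- Weight 1 occurs at vertex 0 on the partition side, while the weights of `A(Δ, r)` are only `Δ
    -- ≥ 2` and 0.
    rw [card_filter_seqWeight lam one_ne_zero (hlen lam), if_pos rfl, Finset.filter_false_of_mem,
      Finset.card_empty] at key
    · omega
    · intro a _
      rcases eq_or_ne a 0 with rfl | ha
      · rw [if_pos rfl]
        omega
      · rw [if_neg ha]
        omega
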